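/- **Theorem.** Let $\lambda>0$. Two point robots $R_1,R_2$ move in the plane with positions $p_i$ and velocities $v_i=\dot p_i$, each steered by an acceleration input $\dot v_i=F_i$ computed from the relative position $x_{ij}=p_j-p_i$ and the relative velocity $v_{ij}=v_j-v_i$ of the other robot. Let $r=\|x_{12}\|$, $V_{rel}=\|v_{12}\|$, and let $V_r$, $V_\theta$ be the components of $v_{12}$ along $x_{12}/r$ and along $x_{12}/r$ turned counter-clockwise by a right angle. Let $\gamma\in[0,\pi]$ be the angle between $v_{ij}$ and $x_{ij}$, and $$\mathcal U_i=\lambda\cos^2\gamma\,\frac{\|v_{ij}\|}{\|x_{ij}\|}\ \text{ if } \tfrac{\pi}{2}<\gamma\le\pi,\qquad \mathcal U_i=0\ \text{ otherwise.}$$ Each robot applies the vortex input $$F_i=\Big(-\frac{\partial\,\mathcal U_i}{\partial (x_{ij})_y},\ \frac{\partial\,\mathcal U_i}{\partial (x_{ij})_x}\Big),$$ the partial derivatives being taken at fixed $v_{ij}$. Suppose that at time $0$ the robots are at distinct positions and on a collision path, that is, $V_r<0$ and $V_\theta=0$. (The initial velocities are otherwise arbitrary; in particular the robots may have the same initial speed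 $V$. No constraint on the speeds is imposed afterwards.) Then the robots never collide. More precisely, there is a $\delta>0$, depending only on $\lambda$ and on the initial positions and velocities, such that for every $T\in(0,\infty]$ and every motion on $[0,T)$ with these initial data (positions continuous, and the equations of motion above holding as long as no collision has occurred), for all $t\in[0,T)$: 1. $r(t)\ge\delta>0$; 2. the closed-loop relative dynamics in polar coordinates hold: $$\dot r=V_r,\qquad \dot V_r=\frac{V_\theta^2}{r}+\frac{4\lambda}{V_{rel}r^2}V_rV_\theta,\qquad \dot V_\theta=-\frac{V_rV_\theta}{r}+\frac{2\lambda}{V_{rel}r^2}V_r^2,$$ where the terms with $\lambda$ are present only while $V_r<0$ (the field is active) and are replaced by $0$ when $V_r\ge0$; 3. if $t>0$, the collision condition ($V_r<0$ and $V_\theta=0$) does not hold at time $t$. -/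

import Mathlib

namespace VortexRobots

noncomputable section

/-- The Cartesian plane with its Euclidean norm. -/
abbrev Plane : Type := EuclideanSpace ℝ (Fin 2)

/-- The repulsive field of a robot, as a function of the position `x` and the velocity `v` of the
other robot relative to it: `lam * (cos γ)^2 * ‖v‖ / ‖x‖` when `π/2 < γ ≤ π`, and `0` otherwise,
where `γ` is the angle between `v` and `x`, that is, `cos γ = ⟪v, x⟫ / (‖v‖ * ‖x‖)`. -/
def repulsiveField (lam : ℝ) (x v : Plane) : ℝ :=
  open Classical in
  if Real.pi / 2 < InnerProductGeometry.angle v x ∧ InnerProductGeometry.angle v x ≤ Real.pi then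
    lam * Real.cos (InnerProductGeometry.angle v x) ^ 2 * (‖v‖ / ‖x‖)
  else 0

/-- Counter-clockwise rotation by a right angle, `(a, b) ↦ (-b, a)`. -/
def rotate (w : Plane) : Plane := !₂[-(w 1), w 0]

/-- The vortex input of a robot: the rotated gradient `(-∂U/∂x_1, ∂U/∂x_0)` of the repulsive field
`U` with respect to the relative position, at a fixed relative velocity. Here `x` and `v` are the
position and velocity of the other robot relative to the robot that applies the input. -/
def vortexInput (lam : ℝ) (x v : Plane) : Plane :=
  rotate (gradient (fun y : Plane => repulsiveField lam y v) x)

/-- The radial relative velocity `V_r`: the component of `v` along the line of sight `x`. -/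
def radialVel (x v : Plane) : ℝ := inner ℝ x v / ‖x‖

/-- The transversal relative velocity `V_θ`: the component of `v` along the line of sight `x`
turned counter-clockwise by a right angle. -/
def transVel (x v : Plane) : ℝ := inner ℝ (rotate x) v / ‖x‖

/-- Two robots at distinct positions are on a collision path: `V_r < 0` and `V_θ = 0`, where `x`
and `v` are the relative position and the relative velocity. -/
def OnCollisionPath (x v : Plane) : Prop :=
  x ≠ 0 ∧ radialVel x v < 0 ∧ transVel x v = 0

/-- `p₁`, `p₂` are positions and `v₁`, `v₂` velocities of two robots on the time interval `[0, T)`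
(with `T = ⊤` allowed), each of which applies its vortex input as acceleration. Positions are
continuous; the equations of motion are required at every time up to which the robots have not
collided, so a collision is not excluded by definition and nothing is assumed about velocities and
accelerations from a collision on. -/
structure IsCooperativeMotion (lam : ℝ) (T : EReal) (p₁ p₂ v₁ v₂ : ℝ → Plane) : Prop where
  continuousOn₁ : ContinuousOn p₁ {t : ℝ | 0 ≤ t ∧ (t : EReal) < T}
  continuousOn₂ : ContinuousOn p₂ {t : ℝ | 0 ≤ t ∧ (t : EReal) < T}
  velocity₁ : ∀ t : ℝ, 0 ≤ t → (t : EReal) < T → (∀ s ∈ Set.Icc 0 t, p₁ s ≠ p₂ s) →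
    HasDerivWithinAt p₁ (v₁ t) (Set.Ici 0) t
  velocity₂ : ∀ t : ℝ, 0 ≤ t → (t : EReal) < T → (∀ s ∈ Set.Icc 0 t, p₁ s ≠ p₂ s) →
    HasDerivWithinAt p₂ (v₂ t) (Set.Ici 0) t
  input₁ : ∀ t : ℝ, 0 ≤ t → (t : EReal) < T → (∀ s ∈ Set.Icc 0 t, p₁ s ≠ p₂ s) →
    HasDerivWithinAt v₁ (vortexInput lam (p₂ t - p₁ t) (v₂ t - v₁ t)) (Set.Ici 0) t
  input₂ : ∀ t : ℝ, 0 ≤ t → (t : EReal) < T → (∀ s ∈ Set.Icc 0 t, p₁ s ≠ p₂ s) →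
    HasDerivWithinAt v₂ (vortexInput lam (p₁ t - p₂ t) (v₁ t - v₂ t)) (Set.Ici 0) t

/-- The closed-loop relative dynamics in polar coordinates at time `t`, for the relative position
`x` and the relative velocity `v` as functions of time, with `r = ‖x‖` and `V_rel = ‖v‖`:
`r' = V_r`,
`V_r' = V_θ² / r + 4 lam / (V_rel r²) V_r V_θ`,
`V_θ' = -V_r V_θ / r + 2 lam / (V_rel r²) V_r²`,
the terms with `lam` being present only while `V_r < 0`, when the field is active. -/
def PolarClosedLoopAt (lam : ℝ) (x v : ℝ → Plane) (t : ℝ) : Prop :=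
  open Classical in
  let r : ℝ := ‖x t‖
  let Vr : ℝ := radialVel (x t) (v t)
  let Vθ : ℝ := transVel (x t) (v t)
  let c : ℝ := if Vr < 0 then lam / (‖v t‖ * r ^ 2) else 0
  HasDerivWithinAt (fun s => ‖x s‖) Vr (Set.Ici 0) t ∧
  HasDerivWithinAt (fun s => radialVel (x s) (v s))
    (Vθ ^ 2 / r + 4 * c * Vr * Vθ) (Set.Ici 0) t ∧
  HasDerivWithinAt (fun s => transVel (x s) (v s))
    (-(Vr * Vθ) / r + 2 * c * Vr ^ 2) (Set.Ici 0) t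

end

end VortexRobots

/-! For the relative position `x` and velocity `v` put `s = ⟪x, v⟫` and `L = ⟪rotate x, v⟫`, so that
`s ^ 2 + L ^ 2 = r ^ 2 * V ^ 2`. The two vortex inputs are opposite, and their effect is that `L`
and `V` never decrease. Since `L` starts at `0` with positive derivative, it is positive at all
later times, which excludes the collision condition (`angular_pos`).

The distance is controlled by the potential `log r + A * L / lam + s / (r * V)`. For `A` large
enough it is nondecreasing (`potential_deriv_nonneg`): the `L` term pays for a nearly radial
approach, the last term for a nearly tangential one. As `L` is bounded (`angular_le`) and `|s| ≤ r *
V`, this bounds `log r` from below (`exists_dist_lower_bound`). Choosing `A` requires a lower bound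
on `r * V` while `r * V ≤ 2 * L`; it comes from the simpler potential `log r + L / lam`
(`angular_lower_bound`).

These estimates hold as long as no collision has occurred and do not depend on the length of the
time interval, so continuity at a first collision time gives a contradiction. -/

namespace VortexRobots

/-! ### The repulsive field and its gradient -/

theorem hasDerivAt_min_zero_sq (s : ℝ) :
    HasDerivAt (fun u : ℝ => min u 0 ^ 2) (2 * min s 0) s := by
  rcases lt_trichotomy s 0 with hs | rfl | hs
  · rw [min_eq_left hs.le]
    have h : HasDerivAt (fun u : ℝ => u ^ 2) (2 * s) s := by simpa using hasDerivAt_pow 2 s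
    refine h.congr_of_eventuallyEq ?_
    filter_upwards [gt_mem_nhds hs] with u hu
    rw [min_eq_left (le_of_lt hu)]
  · rw [hasDerivAt_iff_tendsto_slope_zero]
    have h : Filter.Tendsto (fun t : ℝ => min t 0) (nhdsWithin 0 {0}ᶜ) (nhds (2 * min 0 0)) := by
      have h' : Continuous fun t : ℝ => min t 0 := by fun_prop
      simpa using (h'.tendsto 0).mono_left nhdsWithin_le_nhds
    refine h.congr fun t => ?_
    rcases lt_or_ge t 0 with ht | ht
    · simp [min_eq_left ht.le]
      field_simp
    · simp [min_eq_right ht]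
  · rw [min_eq_right hs.le, mul_zero]
    refine (hasDerivAt_const s (0 : ℝ)).congr_of_eventuallyEq ?_
    filter_upwards [lt_mem_nhds hs] with u hu
    rw [min_eq_right (le_of_lt hu)]
    simp

/-- The condition `γ > π/2` means that the inner product is negative. Since `min u 0 ^ 2` is `C¹`,
this form is differentiable across the switching line without a case split. -/
theorem repulsiveField_eq (lam : ℝ) (x v : Plane) :
    repulsiveField lam x v = lam / ‖v‖ * (min (inner ℝ v x) 0 ^ 2 * (‖x‖ ^ 3)⁻¹) := by
  unfold repulsiveField
  rcases eq_or_ne v 0 with rfl | hv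
  · simp
  rcases eq_or_ne x 0 with rfl | hx
  · simp
  have hv' := norm_pos_iff.2 hv
  have hx' := norm_pos_iff.2 hx
  have hc : Real.cos (InnerProductGeometry.angle v x) = inner ℝ v x / (‖v‖ * ‖x‖) :=
    InnerProductGeometry.cos_angle v x
  have hiff : Real.pi / 2 < InnerProductGeometry.angle v x ↔ inner ℝ v x < 0 := by
    rw [InnerProductGeometry.angle, ← Real.arccos_zero,
      Real.strictAntiOn_arccos.lt_iff_gt (by norm_num)
        (abs_le.1 (abs_real_inner_div_norm_mul_norm_le_one v x)), div_neg_iff]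
    have := mul_pos hv' hx'
    constructor
    · rintro (h | h)
      · linarith
      · exact h.1
    · exact fun h => Or.inr ⟨h, this⟩
  by_cases h : inner ℝ v x < 0
  · rw [if_pos ⟨hiff.2 h, InnerProductGeometry.angle_le_pi v x⟩, hc, min_eq_left h.le]
    field_simp
  · rw [if_neg fun h' => h (hiff.1 h'.1), min_eq_right (not_lt.1 h)]
    simp

theorem hasDerivAt_inv_sqrt_cube {r : ℝ} (hr : 0 < r) :
    HasDerivAt (fun q : ℝ => (√q ^ 3)⁻¹) (-3 / (2 * r ^ 5)) (r ^ 2) := by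
  have h := (((hasDerivAt_id (r ^ 2)).sqrt (by simp; positivity)).pow 3).inv
    (by simp [Real.sqrt_sq hr.le]; positivity)
  refine h.congr_deriv ?_
  simp [Real.sqrt_sq hr.le]
  field_simp

/-- The gradient of the repulsive field with respect to the relative position. -/
theorem hasGradientAt_repulsiveField (lam : ℝ) {x : Plane} (v : Plane) (hx : x ≠ 0) :
    HasGradientAt (fun y : Plane => repulsiveField lam y v)
      ((lam / ‖v‖) • ((2 * min (inner ℝ x v) 0 / ‖x‖ ^ 3) • v
        - (3 * min (inner ℝ x v) 0 ^ 2 / ‖x‖ ^ 5) • x)) x := by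
  have hx' := norm_pos_iff.2 hx
  have hm := (hasDerivAt_min_zero_sq (inner ℝ v x)).comp_hasFDerivAt x
    ((innerSL ℝ v).hasFDerivAt (x := x))
  have hn := (hasDerivAt_inv_sqrt_cube hx').comp_hasFDerivAt x
    (hasStrictFDerivAt_norm_sq x).hasFDerivAt
  have h := (hm.mul hn).const_mul (lam / ‖v‖)
  rw [hasGradientAt_iff_hasFDerivAt]
  refine (h.congr_fderiv ?_).congr_of_eventuallyEq (Filter.Eventually.of_forall fun y => ?_)
  · ext w
    simp [Real.sqrt_sq hx'.le, real_inner_comm v x]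
    field_simp
    ring
  · simp [repulsiveField_eq, Real.sqrt_sq (norm_nonneg y)]

/-! ### The rotation and the relative acceleration -/

/-- `rotate` as a continuous linear map. -/
noncomputable def rotateL : Plane →L[ℝ] Plane :=
  LinearMap.toContinuousLinearMap
    { toFun := rotate
      map_add' := fun a b => by ext i; fin_cases i <;> simp [rotate]; ring
      map_smul' := fun a b => by ext i; fin_cases i <;> simp [rotate] }

theorem rotateL_apply (w : Plane) : rotateL w = rotate w := rfl

theorem inner_rotate_rotate (a b : Plane) : inner ℝ (rotate a) (rotate b) = inner ℝ a b := by
  simp [rotate, PiLp.inner_apply, Fin.sum_univ_two]; ring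

theorem inner_rotate_left (a b : Plane) : inner ℝ (rotate a) b = -inner ℝ a (rotate b) := by
  simp [rotate, PiLp.inner_apply, Fin.sum_univ_two]

theorem inner_rotate_self (a : Plane) : inner ℝ (rotate a) a = 0 := by
  simp [rotate, PiLp.inner_apply, Fin.sum_univ_two]; ring

theorem inner_sq_add_inner_rotate_sq (a b : Plane) :
    inner ℝ a b ^ 2 + inner ℝ (rotate a) b ^ 2 = ‖a‖ ^ 2 * ‖b‖ ^ 2 := by
  simp [rotate, PiLp.inner_apply, Fin.sum_univ_two, EuclideanSpace.real_norm_sq_eq]; ring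

/-- The acceleration of the second robot relative to the first one. -/
theorem vortexInput_sub (lam : ℝ) {x : Plane} (v : Plane) (hx : x ≠ 0) :
    vortexInput lam (-x) (-v) - vortexInput lam x v =
      (-2 * (lam / ‖v‖)) • ((2 * min (inner ℝ x v) 0 / ‖x‖ ^ 3) • rotate v
        - (3 * min (inner ℝ x v) 0 ^ 2 / ‖x‖ ^ 5) • rotate x) := by
  unfold vortexInput
  rw [(hasGradientAt_repulsiveField lam v hx).gradient,
    (hasGradientAt_repulsiveField lam (-v) (neg_ne_zero.2 hx)).gradient]
  -- The inner product is unchanged when `x` and `v` both change sign, so the two gradients are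
  -- opposite.
  simp only [← rotateL_apply, map_smul, map_sub, map_neg, norm_neg, inner_neg_neg]
  module

theorem inner_vortexInput_sub (lam : ℝ) {x : Plane} (v : Plane) (hx : x ≠ 0) :
    inner ℝ x (vortexInput lam (-x) (-v) - vortexInput lam x v) =
      4 * lam * min (inner ℝ x v) 0 * inner ℝ (rotate x) v / (‖v‖ * ‖x‖ ^ 3) := by
  have h : inner ℝ x (rotate x) = 0 := by rw [real_inner_comm, inner_rotate_self]
  rw [vortexInput_sub lam v hx, inner_rotate_left]
  simp only [real_inner_smul_right, inner_sub_right, h]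
  ring

theorem min_zero_sq (s : ℝ) : min s 0 * s = min s 0 ^ 2 := by
  rcases le_total s 0 with h | h <;> simp [h]; ring

theorem inner_rotate_vortexInput_sub (lam : ℝ) {x : Plane} (v : Plane) (hx : x ≠ 0) :
    inner ℝ (rotate x) (vortexInput lam (-x) (-v) - vortexInput lam x v) =
      2 * lam * min (inner ℝ x v) 0 ^ 2 / (‖v‖ * ‖x‖ ^ 3) := by
  have hx' := norm_pos_iff.2 hx
  rw [vortexInput_sub lam v hx]
  simp only [real_inner_smul_right, inner_sub_right, inner_rotate_rotate]
  simp only [real_inner_self_eq_norm_sq, mul_assoc, div_mul_eq_mul_div, min_zero_sq]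
  rcases eq_or_ne v 0 with rfl | hv
  · simp
  have hv' := norm_pos_iff.2 hv
  field_simp
  ring

theorem inner_velocity_vortexInput_sub (lam : ℝ) {x : Plane} (v : Plane) (hx : x ≠ 0) :
    inner ℝ v (vortexInput lam (-x) (-v) - vortexInput lam x v) =
      6 * lam * min (inner ℝ x v) 0 ^ 2 * inner ℝ (rotate x) v / (‖v‖ * ‖x‖ ^ 5) := by
  have h : inner ℝ v (rotate v) = 0 := by rw [real_inner_comm, inner_rotate_self]
  rw [vortexInput_sub lam v hx, real_inner_comm v (rotate x)]
  simp only [real_inner_smul_right, inner_sub_right, h]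
  ring

/-! ### Scalar form of the motion and the derivative inequalities -/

open Set

/-- The relative motion on `[0, b]` in terms of the distance `r`, the relative speed `V`, and the
inner products `s`, `L` of the relative velocity with the relative position and with its rotation
by a right angle. -/
structure IsScalarMotion (lam b : ℝ) (r V s L : ℝ → ℝ) : Prop where
  dist_pos : ∀ t ∈ Icc 0 b, 0 < r t
  speed_nonneg : ∀ t ∈ Icc 0 b, 0 ≤ V t
  sq_add_sq : ∀ t ∈ Icc 0 b, s t ^ 2 + L t ^ 2 = r t ^ 2 * V t ^ 2
  deriv_dist : ∀ t ∈ Icc 0 b, HasDerivWithinAt r (s t / r t) (Icc 0 b) t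
  deriv_speed_sq : ∀ t ∈ Icc 0 b, HasDerivWithinAt (fun u => V u ^ 2)
    (12 * lam * min (s t) 0 ^ 2 * L t / (V t * r t ^ 5)) (Icc 0 b) t
  deriv_inner : ∀ t ∈ Icc 0 b, HasDerivWithinAt s
    (V t ^ 2 + 4 * lam * min (s t) 0 * L t / (V t * r t ^ 3)) (Icc 0 b) t
  deriv_angular : ∀ t ∈ Icc 0 b, HasDerivWithinAt L
    (2 * lam * min (s t) 0 ^ 2 / (V t * r t ^ 3)) (Icc 0 b) t

theorem monotoneOn_Icc_of_hasDerivWithinAt {a b : ℝ} {f f' : ℝ → ℝ}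
    (hf : ∀ t ∈ Icc a b, HasDerivWithinAt f (f' t) (Icc a b) t)
    (hf' : ∀ t ∈ Ioo a b, 0 ≤ f' t) : MonotoneOn f (Icc a b) := by
  refine monotoneOn_of_hasDerivWithinAt_nonneg (f' := f') (convex_Icc a b)
    (fun t ht => (hf t ht).continuousWithinAt) ?_ ?_
  · intro t ht
    exact (hf t (interior_subset ht)).mono interior_subset
  · rw [interior_Icc]
    exact hf'

theorem log_potential_deriv_nonneg {r V s L : ℝ} (hr : 0 < r) (hV : 0 < V)
    (hL : 0 ≤ L) (h : s ^ 2 + L ^ 2 = r ^ 2 * V ^ 2) (hLV : 2 * L ≤ r * V) :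
    0 ≤ s / r / r + 2 * min s 0 ^ 2 / (V * r ^ 3) := by
  rcases le_total 0 s with hs | hs
  · positivity
  · rw [min_eq_left hs]
    have h1 : r * V ≤ 2 * -s := by
      apply abs_le_of_sq_le_sq' _ (by linarith) |>.2
      have := mul_pos hr hV
      nlinarith
    have h2 : s / r / r + 2 * s ^ 2 / (V * r ^ 3) = -s * (2 * -s - r * V) / (V * r ^ 3) := by
      field_simp
      ring
    rw [h2]
    have := mul_nonneg (neg_nonneg.2 hs) (sub_nonneg.2 h1)
    positivity

/-- The left side is the derivative of `L ^ 2 + min s 0 ^ 2`. For `s ≤ 0` its sign is decided by `6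
* lam * |s| * L ≤ 3 * lam * (r * V) ^ 2 ≤ (r * V) ^ 3`. -/
theorem angular_bound_deriv_nonpos {lam r V s L : ℝ} (hlam : 0 < lam) (hr : 0 < r) (hV : 0 < V)
    (h : s ^ 2 + L ^ 2 = r ^ 2 * V ^ 2) (hQ : 9 * lam ^ 2 ≤ L ^ 2 + min s 0 ^ 2) :
    2 * L * (2 * lam * min s 0 ^ 2 / (V * r ^ 3)) +
      2 * min s 0 * (V ^ 2 + 4 * lam * min s 0 * L / (V * r ^ 3)) ≤ 0 := by
  rcases le_total 0 s with hs | hs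
  · simp [hs]
  · rw [min_eq_left hs] at *
    have h1 : 3 * lam ≤ r * V := by
      apply abs_le_of_sq_le_sq' _ (by positivity) |>.2
      nlinarith
    have h2 : 2 * L * (2 * lam * s ^ 2 / (V * r ^ 3)) +
        2 * s * (V ^ 2 + 4 * lam * s * L / (V * r ^ 3)) =
        -(2 * -s * (V ^ 3 * r ^ 3 - 6 * lam * (-s * L)) / (V * r ^ 3)) := by
      field_simp
      ring
    have h3 : 0 ≤ V ^ 3 * r ^ 3 - 6 * lam * (-s * L) := by
      have h4 : 2 * (-s * L) ≤ r ^ 2 * V ^ 2 := by nlinarith [sq_nonneg (s + L)]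
      have h5 : 3 * lam * (2 * (-s * L)) ≤ 3 * lam * (r ^ 2 * V ^ 2) := by gcongr
      have h6 : 3 * lam * (r ^ 2 * V ^ 2) ≤ r * V * (r ^ 2 * V ^ 2) := by gcongr
      nlinarith
    rw [h2, neg_nonpos]
    have := neg_nonneg.2 hs
    positivity

/-- The derivative of the main potential while `s ≤ 0`, up to a positive factor, with `a = -s / (r *
V)`, `b = L / (r * V)`, `u = r * V / lam`. Only for `b` above `1/2` can the last summand be
negative, and then it is at least `-4 * a`. -/
theorem normalized_potential_deriv_nonneg {A u k a b : ℝ} (hu : 0 < u) (ha : 0 ≤ a) (hb : 0 ≤ b)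
    (hab : a ^ 2 + b ^ 2 = 1) (hA : 1 ≤ A) (hkA : (k + 1) ^ 2 ≤ 2 * A)
    (hbu : 1 ≤ 2 * b → 4 ≤ k * u) :
    0 ≤ u * (-a + 2 * A * a ^ 2 + b ^ 2) + 2 * a * b * (3 * a ^ 2 - 2) := by
  rcases le_total (2 * b) 1 with h | h
  · have h1 : 3 / 4 ≤ a ^ 2 := by nlinarith
    have h2 : 1 / 2 ≤ a := by nlinarith
    have h3 : 0 ≤ -a + 2 * A * a ^ 2 + b ^ 2 := by nlinarith [mul_nonneg (sub_nonneg.2 hA) (sq_nonneg a)]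
    have h4 : 0 ≤ 3 * a ^ 2 - 2 := by linarith
    positivity
  -- Here `b ^ 2 ≥ 1 / 4` completes the square `((k + 1) * a - 1 / 2) ^ 2`.
  · have h1 : k * a ≤ -a + 2 * A * a ^ 2 + b ^ 2 := by
      nlinarith [sq_nonneg ((k + 1) * a - 1 / 2), mul_le_mul_of_nonneg_right hkA (sq_nonneg a)]
    have h2 : u * (k * a) ≤ u * (-a + 2 * A * a ^ 2 + b ^ 2) := by gcongr
    have h3 : 4 * a ≤ k * u * a := by gcongr; exact hbu h
    have hb1 : b ≤ 1 := by nlinarith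
    have h4 : a * b ≤ a * 1 := by gcongr
    nlinarith [mul_nonneg (mul_nonneg ha hb) (sq_nonneg a)]

theorem potential_deriv_nonneg {lam A k r V s L : ℝ} (hlam : 0 < lam) (hr : 0 < r) (hV : 0 < V)
    (hL : 0 ≤ L) (h : s ^ 2 + L ^ 2 = r ^ 2 * V ^ 2) (hA : 1 ≤ A)
    (hkA : (k + 1) ^ 2 ≤ 2 * A) (hLk : r * V ≤ 2 * L → 4 * lam ≤ k * (r * V)) :
    0 ≤ s / r / r + A * (2 * lam * min s 0 ^ 2 / (V * r ^ 3)) / lam +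
      ((V ^ 2 + 4 * lam * min s 0 * L / (V * r ^ 3)) * (r * V) -
        s * (s / r * V + r * (6 * lam * min s 0 ^ 2 * L / (V ^ 2 * r ^ 5)))) / (r * V) ^ 2 := by
  have hrV := mul_pos hr hV
  rcases le_total 0 s with hs | hs
  · rw [min_eq_right hs]
    have h1 : s / r / r + A * (2 * lam * 0 ^ 2 / (V * r ^ 3)) / lam +
      ((V ^ 2 + 4 * lam * 0 * L / (V * r ^ 3)) * (r * V) -
        s * (s / r * V + r * (6 * lam * 0 ^ 2 * L / (V ^ 2 * r ^ 5)))) / (r * V) ^ 2 =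
        s / r / r + (r ^ 2 * V ^ 2 - s ^ 2) / (r ^ 3 * V) := by
      field_simp
      ring
    rw [h1, ← h]
    have : s ^ 2 + L ^ 2 - s ^ 2 = L ^ 2 := by ring
    rw [this]
    positivity
  · rw [min_eq_left hs]
    have h1 : s / r / r + A * (2 * lam * s ^ 2 / (V * r ^ 3)) / lam +
      ((V ^ 2 + 4 * lam * s * L / (V * r ^ 3)) * (r * V) -
        s * (s / r * V + r * (6 * lam * s ^ 2 * L / (V ^ 2 * r ^ 5)))) / (r * V) ^ 2 =
        s / r / r + 2 * A * s ^ 2 / (V * r ^ 3) + (r ^ 2 * V ^ 2 - s ^ 2) / (r ^ 3 * V) +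
        4 * lam * s * L / (V ^ 2 * r ^ 4) - 6 * lam * s ^ 3 * L / (V ^ 4 * r ^ 6) := by
      field_simp
      ring
    have h2 : s / r / r + 2 * A * s ^ 2 / (V * r ^ 3) + L ^ 2 / (r ^ 3 * V) +
        4 * lam * s * L / (V ^ 2 * r ^ 4) - 6 * lam * s ^ 3 * L / (V ^ 4 * r ^ 6) =
        lam / r ^ 2 * (r * V / lam *
          (-(-s / (r * V)) + 2 * A * (-s / (r * V)) ^ 2 + (L / (r * V)) ^ 2) +
          2 * (-s / (r * V)) * (L / (r * V)) * (3 * (-s / (r * V)) ^ 2 - 2)) := by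
      field_simp
      ring
    rw [h1, ← h, add_sub_cancel_left, h2]
    have hs' := neg_nonneg.2 hs
    refine mul_nonneg (by positivity) (normalized_potential_deriv_nonneg (k := k) (by positivity)
      (by positivity) (by positivity) ?_ hA hkA fun hb => ?_)
    · rw [div_pow, div_pow, ← add_div, neg_sq, h, ← mul_pow, div_self (by positivity)]
    · rw [← mul_div_assoc, le_div_iff₀ hlam]
      refine hLk ?_
      rw [← mul_div_assoc, le_div_iff₀ hrV] at hb
      linarith

/-! ### A priori bounds along the motion -/

namespace IsScalarMotion

variable {lam b : ℝ} {r V s L : ℝ → ℝ}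

theorem angular_monotoneOn (h : IsScalarMotion lam b r V s L) (hlam : 0 < lam) :
    MonotoneOn L (Icc 0 b) :=
  monotoneOn_Icc_of_hasDerivWithinAt h.deriv_angular fun t ht => by
    have := h.dist_pos t (Ioo_subset_Icc_self ht)
    have := h.speed_nonneg t (Ioo_subset_Icc_self ht)
    positivity

theorem angular_nonneg (h : IsScalarMotion lam b r V s L) (hlam : 0 < lam) (hL : L 0 = 0)
    {t : ℝ} (ht : t ∈ Icc 0 b) : 0 ≤ L t :=
  hL ▸ h.angular_monotoneOn hlam ⟨le_rfl, ht.1.trans ht.2⟩ ht ht.1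

theorem angular_pos (h : IsScalarMotion lam b r V s L) (hlam : 0 < lam) (hL : L 0 = 0)
    (hV : 0 < V 0) (hs : s 0 < 0) (hb : 0 < b) : 0 < L b := by
  have hb' : b ∈ Icc 0 b := ⟨hb.le, le_rfl⟩
  have h0 : (0 : ℝ) ∈ Icc 0 b := ⟨le_rfl, hb.le⟩
  refine lt_of_le_of_ne (h.angular_nonneg hlam hL hb') fun hLb => ?_
  have hconst : ∀ t ∈ Icc 0 b, L t = 0 := fun t ht =>
    le_antisymm (hLb ▸ h.angular_monotoneOn hlam ht hb' ht.2) (h.angular_nonneg hlam hL ht)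
  have h1 : HasDerivWithinAt L 0 (Icc 0 b) 0 :=
    (hasDerivWithinAt_const 0 (Icc 0 b) (0 : ℝ)).congr hconst (hconst 0 h0)
  have h2 := (uniqueDiffOn_Icc hb 0 h0).eq_deriv _ h1 (h.deriv_angular 0 h0)
  have h3 := h.dist_pos 0 h0
  rw [min_eq_left hs.le] at h2
  have : 0 < 2 * lam * s 0 ^ 2 / (V 0 * r 0 ^ 3) := by
    have := pow_pos (neg_pos.2 hs) 2
    rw [neg_sq] at this
    positivity
  exact this.ne h2

theorem le_speed (h : IsScalarMotion lam b r V s L) (hlam : 0 < lam) (hL : L 0 = 0)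
    {t : ℝ} (ht : t ∈ Icc 0 b) : V 0 ≤ V t := by
  have h0 : (0 : ℝ) ∈ Icc 0 b := ⟨le_rfl, ht.1.trans ht.2⟩
  have hmono := monotoneOn_Icc_of_hasDerivWithinAt h.deriv_speed_sq fun u hu => by
    have hu := Ioo_subset_Icc_self hu
    have := h.dist_pos u hu
    have := h.speed_nonneg u hu
    have := h.angular_nonneg hlam hL hu
    positivity
  exact (abs_le_of_sq_le_sq' (hmono h0 ht ht.1) (h.speed_nonneg t ht)).2

theorem deriv_speed (h : IsScalarMotion lam b r V s L) {t : ℝ} (ht : t ∈ Icc 0 b) (hV : 0 < V t) :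
    HasDerivWithinAt V (6 * lam * min (s t) 0 ^ 2 * L t / (V t ^ 2 * r t ^ 5)) (Icc 0 b) t := by
  have h1 := (h.deriv_speed_sq t ht).sqrt (by positivity)
  refine (h1.congr (fun u hu => (Real.sqrt_sq (h.speed_nonneg u hu)).symm)
    (Real.sqrt_sq hV.le).symm).congr_deriv ?_
  have := h.dist_pos t ht
  rw [Real.sqrt_sq hV.le]
  field_simp
  ring

theorem angular_le (h : IsScalarMotion lam b r V s L) (hlam : 0 < lam) (hL : L 0 = 0)
    (hV : 0 < V 0) {t : ℝ} (ht : t ∈ Icc 0 b) : L t ≤ max (r 0 * V 0) (3 * lam) := by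
  -- The first entry dominates the initial value of `L ^ 2 + min s 0 ^ 2`; above the square of the
  -- second this quantity cannot grow.
  set K := max (r 0 * V 0) (3 * lam) with hK
  have h0 : (0 : ℝ) ∈ Icc 0 b := ⟨le_rfl, ht.1.trans ht.2⟩
  have hK0 : 3 * lam ≤ K := le_max_right _ _
  -- The squared excess over `K ^ 2` is differentiable and nonincreasing, and it starts at `0`,
  -- hence it stays `0`.
  have hmono := monotoneOn_Icc_of_hasDerivWithinAt (f := fun u =>
      -min (K ^ 2 - (L u ^ 2 + min (s u) 0 ^ 2)) 0 ^ 2) (a := 0) (b := b)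
    (fun u hu => (((hasDerivAt_min_zero_sq _).comp_hasDerivWithinAt u
      ((((h.deriv_angular u hu).pow 2).add
        ((hasDerivAt_min_zero_sq _).comp_hasDerivWithinAt u (h.deriv_inner u hu))).const_sub
          (K ^ 2))).neg)) (fun u hu => by
      have hu := Ioo_subset_Icc_self hu
      rcases le_total 0 (K ^ 2 - (L u ^ 2 + min (s u) 0 ^ 2)) with hQ | hQ
      · simp [hQ]
      · have h1 := angular_bound_deriv_nonpos hlam (h.dist_pos u hu)
          (hV.trans_le (h.le_speed hlam hL hu))
          (h.sq_add_sq u hu) (by nlinarith)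
        simp only [Pi.add_apply, Pi.pow_apply, Function.comp_apply, min_eq_left hQ]
        norm_num
        nlinarith)
  have h1 := hmono h0 ht ht.1
  have h2 : min (K ^ 2 - (L 0 ^ 2 + min (s 0) 0 ^ 2)) 0 = 0 := by
    refine min_eq_right (sub_nonneg.2 ?_)
    have h3 : min (s 0) 0 ^ 2 ≤ s 0 ^ 2 := by
      rcases le_total (s 0) 0 with hs | hs <;> simp [hs]
    have h4 : (r 0 * V 0) ^ 2 ≤ K ^ 2 := by
      have := h.dist_pos 0 h0
      gcongr
      exact le_max_left _ _
    nlinarith [h.sq_add_sq 0 h0]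
  simp only [h2] at h1
  have h3 : min (K ^ 2 - (L t ^ 2 + min (s t) 0 ^ 2)) 0 = 0 := by
    apply pow_eq_zero_iff two_ne_zero |>.1
    nlinarith [sq_nonneg (min (K ^ 2 - (L t ^ 2 + min (s t) 0 ^ 2)) 0)]
  have h4 := min_eq_right_iff.1 h3
  refine (abs_le_of_sq_le_sq' ?_ (by linarith)).2
  nlinarith [sq_nonneg (min (s t) 0)]

theorem angular_lower_bound (h : IsScalarMotion lam b r V s L) (hlam : 0 < lam) (hL : L 0 = 0)
    (hV : 0 < V 0) {t : ℝ} (ht : t ∈ Icc 0 b) (htL : r t * V t ≤ 2 * L t) :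
    V 0 * (r 0 * Real.exp (-(max (r 0 * V 0) (3 * lam) / lam))) / 2 ≤ L t := by
  have h0 : (0 : ℝ) ∈ Icc 0 b := ⟨le_rfl, ht.1.trans ht.2⟩
  have hVpos : ∀ u ∈ Icc 0 b, 0 < V u := fun u hu => hV.trans_le (h.le_speed hlam hL hu)
  have hcont : ContinuousOn (fun u => 2 * L u - r u * V u) (Icc 0 b) := fun u hu =>
    (((h.deriv_angular u hu).continuousWithinAt.const_mul 2).sub
      ((h.deriv_dist u hu).continuousWithinAt.mul
        (h.deriv_speed hu (hVpos u hu)).continuousWithinAt))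
  have hcomp : IsCompact (Icc 0 t ∩ (fun u => 2 * L u - r u * V u) ⁻¹' Ici 0) :=
    isCompact_Icc.of_isClosed_subset
      ((hcont.mono (Icc_subset_Icc_right ht.2)).preimage_isClosed_of_isClosed
        isClosed_Icc isClosed_Ici) inter_subset_left
  -- At the first time `τ` with `r * V ≤ 2 * L`, the potential `log r + L / lam` has only increased,
  -- so `r τ` is bounded below; afterwards `L` does not decrease.
  obtain ⟨τ, ⟨hτ, hτL⟩, hmin⟩ := hcomp.exists_isLeast
    ⟨t, ⟨ht.1, le_rfl⟩, by simpa using htL⟩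
  simp only [mem_preimage, mem_Ici, sub_nonneg] at hτL
  have hτb : τ ∈ Icc 0 b := ⟨hτ.1, hτ.2.trans ht.2⟩
  have hsub : Icc 0 τ ⊆ Icc 0 b := Icc_subset_Icc_right hτb.2
  have hmono := monotoneOn_Icc_of_hasDerivWithinAt (f := fun u => Real.log (r u) + L u / lam)
    (a := 0) (b := τ) (fun u hu => (((h.deriv_dist u (hsub hu)).log
      (h.dist_pos u (hsub hu)).ne').add ((h.deriv_angular u (hsub hu)).div_const lam)).mono hsub)
    (fun u hu => by
      have hu' := hsub (Ioo_subset_Icc_self hu)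
      have hlt : 2 * L u ≤ r u * V u := by
        by_contra! hcon
        exact hu.2.not_ge (hmin ⟨⟨hu.1.le, hu.2.le.trans hτ.2⟩, by simpa using hcon.le⟩)
      have h1 := log_potential_deriv_nonneg (h.dist_pos u hu') (hVpos u hu')
        (h.angular_nonneg hlam hL hu') (h.sq_add_sq u hu') hlt
      convert h1 using 2
      field_simp)
  have h1 := hmono ⟨le_rfl, hτ.1⟩ ⟨hτ.1, le_rfl⟩ hτ.1
  simp only [hL, zero_div, add_zero] at h1
  have h2 : L τ / lam ≤ max (r 0 * V 0) (3 * lam) / lam := by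
    gcongr
    exact h.angular_le hlam hL hV hτb
  have hr0 := h.dist_pos 0 h0
  have hrτ := h.dist_pos τ hτb
  have h3 : r 0 * Real.exp (-(max (r 0 * V 0) (3 * lam) / lam)) ≤ r τ := by
    rw [← Real.log_le_log_iff (by positivity) hrτ, Real.log_mul hr0.ne' (Real.exp_pos _).ne',
      Real.log_exp]
    linarith
  have h4 : V 0 * (r 0 * Real.exp (-(max (r 0 * V 0) (3 * lam) / lam))) ≤ V τ * r τ := by
    have := hVpos τ hτb
    gcongr
    exact h.le_speed hlam hL hτb
  have h5 := h.angular_monotoneOn hlam hτb ht hτ.2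
  linarith

end IsScalarMotion

/-- The distance stays above a bound that depends on the initial distance and speed only. -/
theorem exists_dist_lower_bound {lam r₀ V₀ : ℝ} (hlam : 0 < lam) (hr₀ : 0 < r₀) (hV₀ : 0 < V₀) :
    ∃ δ : ℝ, 0 < δ ∧ ∀ (b : ℝ) (r V s L : ℝ → ℝ), 0 ≤ b → IsScalarMotion lam b r V s L →
      r 0 = r₀ → V 0 = V₀ → L 0 = 0 → δ ≤ r b := by
  set K := max (r₀ * V₀) (3 * lam) with hK
  set l := V₀ * (r₀ * Real.exp (-(K / lam))) / 2 with hl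
  have hlpos : 0 < l := by positivity
  set k := 4 * lam / l with hk
  have hkpos : 0 < k := by positivity
  -- Chosen so that both `1 ≤ A` and `(k + 1) ^ 2 ≤ 2 * A`.
  set A := (k + 1) ^ 2 / 2 + 1 with hA
  have hA1 : 1 ≤ A := le_add_of_nonneg_left (by positivity)
  -- `K` bounds `L`, and `2` bounds the variation of `s / (r * V)`, which lies in `[-1, 1]`.
  refine ⟨r₀ * Real.exp (-(A * K / lam + 2)), by positivity, ?_⟩
  intro b r V s L hb h hr hV hL
  have h0 : (0 : ℝ) ∈ Icc 0 b := ⟨le_rfl, hb⟩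
  have hb' : b ∈ Icc 0 b := ⟨hb, le_rfl⟩
  have hV0 : 0 < V 0 := hV ▸ hV₀
  have hVpos : ∀ u ∈ Icc 0 b, 0 < V u := fun u hu => hV0.trans_le (h.le_speed hlam hL hu)
  have habs : ∀ u ∈ Icc 0 b, |s u / (r u * V u)| ≤ 1 := fun u hu => by
    have := mul_pos (h.dist_pos u hu) (hVpos u hu)
    rw [abs_div, abs_of_pos this, div_le_one this]
    refine abs_le_of_sq_le_sq ?_ this.le
    nlinarith [h.sq_add_sq u hu, sq_nonneg (L u)]
  have hmono := monotoneOn_Icc_of_hasDerivWithinAt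
    (f := fun u => Real.log (r u) + A * L u / lam + s u / (r u * V u)) (a := 0) (b := b)
    (fun u hu => (((h.deriv_dist u hu).log (h.dist_pos u hu).ne').add
      (((h.deriv_angular u hu).const_mul A).div_const lam)).add
      ((h.deriv_inner u hu).div ((h.deriv_dist u hu).mul (h.deriv_speed hu (hVpos u hu)))
        (mul_pos (h.dist_pos u hu) (hVpos u hu)).ne'))
    (fun u hu => by
      have hu := Ioo_subset_Icc_self hu
      refine potential_deriv_nonneg (k := k) hlam (h.dist_pos u hu) (hVpos u hu)
        (h.angular_nonneg hlam hL hu) (h.sq_add_sq u hu) hA1 (by rw [hA]; linarith) ?_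
      intro huL
      have h1 := h.angular_lower_bound hlam hL hV0 hu huL
      rw [hr, hV, ← hK, ← hl] at h1
      have h2 : L u ≤ r u * V u := by
        refine (abs_le_of_sq_le_sq' ?_ (mul_pos (h.dist_pos u hu) (hVpos u hu)).le).2
        nlinarith [h.sq_add_sq u hu, sq_nonneg (s u)]
      calc 4 * lam = k * l := by rw [hk]; field_simp
        _ ≤ k * (r u * V u) := by gcongr; exact h1.trans h2)
  have h1 := hmono h0 hb' hb
  simp only [hL, mul_zero, zero_div, add_zero] at h1
  have h2 : A * L b / lam ≤ A * K / lam := by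
    gcongr
    have := h.angular_le hlam hL hV0 hb'
    rwa [hr, hV] at this
  have h3 := (abs_le.1 (habs 0 h0)).1
  have h4 := (abs_le.1 (habs b hb')).2
  rw [← Real.log_le_log_iff (by positivity) (h.dist_pos b hb'),
    Real.log_mul hr₀.ne' (Real.exp_pos _).ne', Real.log_exp, ← hr]
  linarith

/-! ### From the planar equations to the scalar and polar ones -/

section RelativeMotion

variable {lam t : ℝ} {x v : ℝ → Plane} {S : Set ℝ}

theorem hasDerivWithinAt_norm_of_ne_zero (hxt : x t ≠ 0)
    (hx : HasDerivWithinAt x (v t) S t) :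
    HasDerivWithinAt (fun u => ‖x u‖) (inner ℝ (x t) (v t) / ‖x t‖) S t := by
  have hpos := norm_pos_iff.2 hxt
  have h := hx.norm_sq.sqrt (by positivity)
  simp only [Real.sqrt_sq (norm_nonneg _)] at h
  refine h.congr_deriv ?_
  field_simp

theorem hasDerivWithinAt_inner_of_vortexInput (hxt : x t ≠ 0)
    (hx : HasDerivWithinAt x (v t) S t)
    (hv : HasDerivWithinAt v
      (vortexInput lam (-x t) (-v t) - vortexInput lam (x t) (v t)) S t) :
    HasDerivWithinAt (fun u => inner ℝ (x u) (v u))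
      (‖v t‖ ^ 2 + 4 * lam * min (inner ℝ (x t) (v t)) 0 * inner ℝ (rotate (x t)) (v t) /
        (‖v t‖ * ‖x t‖ ^ 3)) S t := by
  refine (hx.inner ℝ hv).congr_deriv ?_
  rw [inner_vortexInput_sub lam (v t) hxt, real_inner_self_eq_norm_sq]
  ring

theorem hasDerivWithinAt_inner_rotate_of_vortexInput (hxt : x t ≠ 0)
    (hx : HasDerivWithinAt x (v t) S t)
    (hv : HasDerivWithinAt v
      (vortexInput lam (-x t) (-v t) - vortexInput lam (x t) (v t)) S t) :
    HasDerivWithinAt (fun u => inner ℝ (rotate (x u)) (v u))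
      (2 * lam * min (inner ℝ (x t) (v t)) 0 ^ 2 / (‖v t‖ * ‖x t‖ ^ 3)) S t := by
  have hrot : HasDerivWithinAt (fun u => rotate (x u)) (rotate (v t)) S t :=
    rotateL.hasFDerivAt.comp_hasDerivWithinAt t hx
  refine (hrot.inner ℝ hv).congr_deriv ?_
  rw [inner_rotate_vortexInput_sub lam (v t) hxt, inner_rotate_self, add_zero]

theorem hasDerivWithinAt_norm_sq_of_vortexInput (hxt : x t ≠ 0)
    (hv : HasDerivWithinAt v
      (vortexInput lam (-x t) (-v t) - vortexInput lam (x t) (v t)) S t) :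
    HasDerivWithinAt (fun u => ‖v u‖ ^ 2)
      (12 * lam * min (inner ℝ (x t) (v t)) 0 ^ 2 * inner ℝ (rotate (x t)) (v t) /
        (‖v t‖ * ‖x t‖ ^ 5)) S t := by
  refine hv.norm_sq.congr_deriv ?_
  rw [inner_velocity_vortexInput_sub lam (v t) hxt]
  ring

theorem isScalarMotion_of_vortexInput {b : ℝ} (hx0 : ∀ t ∈ Icc 0 b, x t ≠ 0)
    (hx : ∀ t ∈ Icc 0 b, HasDerivWithinAt x (v t) (Ici 0) t)
    (hv : ∀ t ∈ Icc 0 b, HasDerivWithinAt v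
      (vortexInput lam (-x t) (-v t) - vortexInput lam (x t) (v t)) (Ici 0) t) :
    IsScalarMotion lam b (fun t => ‖x t‖) (fun t => ‖v t‖) (fun t => inner ℝ (x t) (v t))
      (fun t => inner ℝ (rotate (x t)) (v t)) where
  dist_pos t ht := norm_pos_iff.2 (hx0 t ht)
  speed_nonneg _ _ := norm_nonneg _
  sq_add_sq _ _ := inner_sq_add_inner_rotate_sq _ _
  deriv_dist t ht := (hasDerivWithinAt_norm_of_ne_zero (hx0 t ht) (hx t ht)).mono Icc_subset_Ici_self
  deriv_speed_sq t ht :=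
    (hasDerivWithinAt_norm_sq_of_vortexInput (hx0 t ht) (hv t ht)).mono Icc_subset_Ici_self
  deriv_inner t ht := (hasDerivWithinAt_inner_of_vortexInput (hx0 t ht) (hx t ht) (hv t ht)).mono
    Icc_subset_Ici_self
  deriv_angular t ht := (hasDerivWithinAt_inner_rotate_of_vortexInput (hx0 t ht) (hx t ht)
    (hv t ht)).mono Icc_subset_Ici_self

theorem polarClosedLoopAt_of_vortexInput (hxt : x t ≠ 0)
    (hx : HasDerivWithinAt x (v t) (Ici 0) t)
    (hv : HasDerivWithinAt v
      (vortexInput lam (-x t) (-v t) - vortexInput lam (x t) (v t)) (Ici 0) t) :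
    PolarClosedLoopAt lam x v t := by
  have hpos := norm_pos_iff.2 hxt
  have hr := hasDerivWithinAt_norm_of_ne_zero hxt hx
  have hs := (hasDerivWithinAt_inner_of_vortexInput hxt hx hv).div hr hpos.ne'
  have hL := (hasDerivWithinAt_inner_rotate_of_vortexInput hxt hx hv).div hr hpos.ne'
  have hsq := inner_sq_add_inner_rotate_sq (x t) (v t)
  have hneg : radialVel (x t) (v t) < 0 ↔ inner ℝ (x t) (v t) < 0 := by
    rw [radialVel, div_lt_iff₀ hpos, zero_mul]
  refine ⟨hr, hs.congr_deriv ?_, hL.congr_deriv ?_⟩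
  · simp only [hneg]
    unfold radialVel transVel
    have key : (‖v t‖ ^ 2 * ‖x t‖ ^ 2 - inner ℝ (x t) (v t) ^ 2) =
        inner ℝ (rotate (x t)) (v t) ^ 2 := by linarith
    by_cases h : inner ℝ (x t) (v t) < 0
    · have hvt : v t ≠ 0 := fun h0 => by simp [h0] at h
      have hvpos := norm_pos_iff.2 hvt
      rw [if_pos h, min_eq_left h.le, div_pow, ← key]
      field_simp
      ring
    · rw [if_neg h, min_eq_right (not_lt.1 h), div_pow, ← key]
      simp only [mul_zero, zero_mul, zero_div, add_zero]
      field_simp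
  · simp only [hneg]
    unfold radialVel transVel
    by_cases h : inner ℝ (x t) (v t) < 0
    · have hvt : v t ≠ 0 := fun h0 => by simp [h0] at h
      have hvpos := norm_pos_iff.2 hvt
      rw [if_pos h, min_eq_left h.le]
      field_simp
      ring
    · rw [if_neg h, min_eq_right (not_lt.1 h)]
      field_simp
      ring

end RelativeMotion

/-! ### The two robots and the exclusion of a first collision -/

namespace IsCooperativeMotion

variable {lam : ℝ} {T : EReal} {p₁ p₂ v₁ v₂ : ℝ → Plane}

theorem hasDerivWithinAt_sub_position (h : IsCooperativeMotion lam T p₁ p₂ v₁ v₂) {t : ℝ}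
    (ht : 0 ≤ t) (htT : (t : EReal) < T) (hne : ∀ s ∈ Icc 0 t, p₁ s ≠ p₂ s) :
    HasDerivWithinAt (fun s => p₂ s - p₁ s) (v₂ t - v₁ t) (Ici 0) t :=
  (h.velocity₂ t ht htT hne).sub (h.velocity₁ t ht htT hne)

theorem hasDerivWithinAt_sub_velocity (h : IsCooperativeMotion lam T p₁ p₂ v₁ v₂) {t : ℝ}
    (ht : 0 ≤ t) (htT : (t : EReal) < T) (hne : ∀ s ∈ Icc 0 t, p₁ s ≠ p₂ s) :
    HasDerivWithinAt (fun s => v₂ s - v₁ s)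
      (vortexInput lam (-(p₂ t - p₁ t)) (-(v₂ t - v₁ t)) -
        vortexInput lam (p₂ t - p₁ t) (v₂ t - v₁ t)) (Ici 0) t := by
  rw [neg_sub, neg_sub]
  exact (h.input₂ t ht htT hne).sub (h.input₁ t ht htT hne)

theorem isScalarMotion (h : IsCooperativeMotion lam T p₁ p₂ v₁ v₂) {b : ℝ}
    (hbT : (b : EReal) < T) (hne : ∀ s ∈ Icc 0 b, p₁ s ≠ p₂ s) :
    IsScalarMotion lam b (fun t => ‖p₂ t - p₁ t‖) (fun t => ‖v₂ t - v₁ t‖)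
      (fun t => inner ℝ (p₂ t - p₁ t) (v₂ t - v₁ t))
      (fun t => inner ℝ (rotate (p₂ t - p₁ t)) (v₂ t - v₁ t)) := by
  have hT : ∀ t ∈ Icc 0 b, (t : EReal) < T := fun t ht =>
    (EReal.coe_le_coe_iff.2 ht.2).trans_lt hbT
  have hne' : ∀ t ∈ Icc 0 b, ∀ s ∈ Icc 0 t, p₁ s ≠ p₂ s := fun t ht s hs =>
    hne s ⟨hs.1, hs.2.trans ht.2⟩
  exact isScalarMotion_of_vortexInput (x := fun t => p₂ t - p₁ t) (v := fun t => v₂ t - v₁ t)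
    (fun t ht => sub_ne_zero.2 (hne t ht).symm)
    (fun t ht => h.hasDerivWithinAt_sub_position ht.1 (hT t ht) (hne' t ht))
    (fun t ht => h.hasDerivWithinAt_sub_velocity ht.1 (hT t ht) (hne' t ht))

end IsCooperativeMotion

/-- A continuous function that is positive at `0`, and above a fixed positive bound at every time
up to which it has not vanished, never vanishes. -/
theorem ne_zero_of_lower_bound_before_zero {b δ : ℝ} {f : ℝ → ℝ} (hδ : 0 < δ)
    (hf : ContinuousOn f (Icc 0 b)) (h0 : f 0 ≠ 0)
    (hbd : ∀ t ∈ Icc 0 b, (∀ s ∈ Icc 0 t, f s ≠ 0) → δ ≤ f t) :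
    ∀ t ∈ Icc 0 b, f t ≠ 0 := by
  by_contra! hcon
  obtain ⟨t, ht, hft⟩ := hcon
  have hcomp : IsCompact (Icc 0 b ∩ f ⁻¹' {0}) :=
    isCompact_Icc.of_isClosed_subset
      (hf.preimage_isClosed_of_isClosed isClosed_Icc isClosed_singleton) inter_subset_left
  obtain ⟨τ, ⟨hτ, hfτ⟩, hmin⟩ := hcomp.exists_isLeast ⟨t, ht, hft⟩
  have hfτ : f τ = 0 := hfτ
  have hτ0 : 0 < τ := hτ.1.lt_of_ne (by rintro rfl; exact h0 hfτ)
  -- Before the first zero `τ` the bound applies, and it passes to `τ` by continuity.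
  have hev : ∀ u ∈ Ico 0 τ, δ ≤ f u := fun u hu =>
    hbd u ⟨hu.1, hu.2.le.trans hτ.2⟩ fun s hs hfs =>
      (hs.2.trans_lt hu.2).not_ge (hmin ⟨⟨hs.1, hs.2.trans (hu.2.le.trans hτ.2)⟩, hfs⟩)
  have hcl : τ ∈ closure (Ico 0 τ) := by
    rw [closure_Ico hτ0.ne]
    exact ⟨hτ0.le, le_rfl⟩
  have hle : δ ≤ f τ := ContinuousWithinAt.closure_le hcl continuousWithinAt_const
    ((hf τ hτ).mono fun u hu => ⟨hu.1, hu.2.le.trans hτ.2⟩) hev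
  linarith

end VortexRobots

open VortexRobots in
theorem theorem1 (lam : ℝ) (hlam : 0 < lam) (a₁ a₂ w₁ w₂ : Plane)
    (hpath : OnCollisionPath (a₂ - a₁) (w₂ - w₁)) :
    ∃ δ : ℝ, 0 < δ ∧
      ∀ (T : EReal) (p₁ p₂ v₁ v₂ : ℝ → Plane),
        IsCooperativeMotion lam T p₁ p₂ v₁ v₂ →
        p₁ 0 = a₁ → p₂ 0 = a₂ → v₁ 0 = w₁ → v₂ 0 = w₂ →
        ∀ t : ℝ, 0 ≤ t → (t : EReal) < T →
          δ ≤ dist (p₁ t) (p₂ t) ∧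
          PolarClosedLoopAt lam (fun s => p₂ s - p₁ s) (fun s => v₂ s - v₁ s) t ∧
          (0 < t → ¬ (radialVel (p₂ t - p₁ t) (v₂ t - v₁ t) < 0 ∧
            transVel (p₂ t - p₁ t) (v₂ t - v₁ t) = 0)) := by
  obtain ⟨hx, hVr, hVθ⟩ := hpath
  have hr : 0 < ‖a₂ - a₁‖ := norm_pos_iff.2 hx
  have hs : inner ℝ (a₂ - a₁) (w₂ - w₁) < 0 := by
    rwa [radialVel, div_lt_iff₀ hr, zero_mul] at hVr
  have hL : inner ℝ (rotate (a₂ - a₁)) (w₂ - w₁) = 0 := by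
    rwa [transVel, div_eq_zero_iff, or_iff_left hr.ne'] at hVθ
  have hV : 0 < ‖w₂ - w₁‖ := norm_pos_iff.2 fun h0 => by simp [h0] at hs
  obtain ⟨δ, hδ, hbound⟩ := exists_dist_lower_bound hlam hr hV
  refine ⟨δ, hδ, ?_⟩
  rintro T p₁ p₂ v₁ v₂ h rfl rfl rfl rfl t ht htT
  have hT : ∀ u ∈ Set.Icc 0 t, (u : EReal) < T := fun u hu =>
    (EReal.coe_le_coe_iff.2 hu.2).trans_lt htT
  have hfree : ∀ u ∈ Set.Icc 0 t, (∀ s ∈ Set.Icc 0 u, p₁ s ≠ p₂ s) → δ ≤ ‖p₂ u - p₁ u‖ :=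
    fun u hu hne => hbound u _ _ _ _ hu.1 (h.isScalarMotion (hT u hu) hne) rfl rfl hL
  have hsub : Set.Icc 0 t ⊆ {u : ℝ | 0 ≤ u ∧ (u : EReal) < T} := fun u hu => ⟨hu.1, hT u hu⟩
  have hiff : ∀ u, ‖p₂ u - p₁ u‖ ≠ 0 ↔ p₁ u ≠ p₂ u := fun u => by
    rw [norm_ne_zero_iff, sub_ne_zero, ne_comm]
  have hne : ∀ u ∈ Set.Icc 0 t, p₁ u ≠ p₂ u := by
    have := ne_zero_of_lower_bound_before_zero (f := fun u => ‖p₂ u - p₁ u‖) hδ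
      ((h.continuousOn₂.mono hsub).sub (h.continuousOn₁.mono hsub)).norm hr.ne'
      (by simpa only [hiff] using hfree)
    simpa only [hiff] using this
  have htt : t ∈ Set.Icc 0 t := ⟨ht, le_rfl⟩
  refine ⟨?_, ?_, ?_⟩
  · rw [dist_comm, dist_eq_norm]
    exact hfree t htt hne
  · exact polarClosedLoopAt_of_vortexInput (x := fun s => p₂ s - p₁ s)
      (v := fun s => v₂ s - v₁ s) (sub_ne_zero.2 (hne t htt).symm)
      (h.hasDerivWithinAt_sub_position ht htT hne) (h.hasDerivWithinAt_sub_velocity ht htT hne)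
  · rintro htpos ⟨-, hVθt⟩
    have hpos := (h.isScalarMotion htT hne).angular_pos hlam hL hV hs htpos
    have hrt : ‖p₂ t - p₁ t‖ ≠ 0 := (hiff t).2 (hne t htt)
    rw [transVel, div_eq_zero_iff, or_iff_left hrt] at hVθt
    exact hpos.ne' hVθt
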